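/- A quantum channel from $\mathbb{C}^{m}$ to $\mathbb{C}^{n}$ is a completely positive trace-preserving linear map from $m\times m$ to $n\times n$ complex matrices; a qubit channel is one with $m=n=2$. A set $\mathcal{S}$ of channels from $Q$ to $Q'$ is said to be \emph{maskable} if there are finite-dimensional systems $A,B$, an isometry $M:\mathcal{H}_{Q'}\to\mathcal{H}_A\otimes\mathcal{H}_B$ (that is, $M^\dagger M=\mathbb{1}$), and channels $\alpha$ from $Q$ to $A$ and $\beta$ from $Q$ to $B$ such that for every $\mathcal{E}\in\mathcal{S}$ $$\alpha(\cdot)=\mathrm{Tr}_B\big[M\,\mathcal{E}(\cdot)\,M^\dagger\big],\qquad \beta(\cdot)=\mathrm{Tr}_A\big[M\,\mathcal{E}(\cdot)\,M^\dagger\big].$$ Corollary. Let $\{\mathcal{E}_\lambda\}_{\lambda}$ be any family of qubit channels. Then the set $\{\mathrm{id},\mathcal{E}_\lambda\}_\lambda$, consisting of the identity channel and all the $\mathcal{E}_\lambda$, is maskable if and only if every $\mathcal{E}_\lambda$ is unital (i.e. $\mathcal{E}_\lambda(\mathbb{1})=\mathbb{1}$) and there is a unit vector $|\psi\rangle\in\mathbb{C}^2$,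 the same for all $\lambda$, with $\mathcal{E}_\lambda(|\psi\rangle\langle\psi|)=|\psi\rangle\langle\psi|$ for every $\lambda$. -/

import Mathlib

open scoped Matrix ComplexOrder Matrix.Norms.L2Operator MatrixOrder CStarAlgebra

noncomputable section

/-- A quantum channel from the system with Hilbert space `ℂ^m` to the one with Hilbert space `ℂ^n`:
a completely positive trace-preserving linear map on matrices.  The matrix algebras carry their
C⋆-structure: the order is the Loewner order, `0 ≤ X ↔ X.PosSemidef`. -/
structure QChannel (m n : Type*) [Fintype m] [DecidableEq m] [Fintype n] [DecidableEq n]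
    extends Matrix m m ℂ →CP Matrix n n ℂ where
  trace_preserving : ∀ X : Matrix m m ℂ, (toFun X).trace = X.trace

namespace QChannel

variable {m n : Type*} [Fintype m] [DecidableEq m] [Fintype n] [DecidableEq n]

/-- The action of a channel on operators. -/
def apply (E : QChannel m n) (X : Matrix m m ℂ) : Matrix n n ℂ := E.toCompletelyPositiveMap X

/-- The ideal (identity) channel `id`. -/
def ident (m : Type*) [Fintype m] [DecidableEq m] : QChannel m m where
  toLinearMap := LinearMap.id
  map_cstarMatrix_nonneg' := fun _ _ hM => hM
  trace_preserving := fun _ => rfl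

/-- `E` is unital: it maps the identity operator to the identity operator. -/
def IsUnital (E : QChannel m n) : Prop := E.apply 1 = 1

end QChannel

/-- The partial trace `Tr_B` of an operator on `ℂ^a ⊗ ℂ^b = ℂ^(a × b)`. -/
def traceB {a b : Type*} [Fintype b] (X : Matrix (a × b) (a × b) ℂ) : Matrix a a ℂ :=
  Matrix.of fun i i' => ∑ j, X (i, j) (i', j)

/-- The partial trace `Tr_A` of an operator on `ℂ^a ⊗ ℂ^b = ℂ^(a × b)`. -/
def traceA {a b : Type*} [Fintype a] (X : Matrix (a × b) (a × b) ℂ) : Matrix b b ℂ :=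
  Matrix.of fun j j' => ∑ i, X (i, j) (i, j')

/-- A set `S` of channels with output space `ℂ^n` can be masked: for some finite-dimensional
systems `A = ℂ^a`, `B = ℂ^b` there are an isometry `M : ℂ^n → ℂ^a ⊗ ℂ^b` and channels `α`, `β`
that are the two reduced channels of `X ↦ M (E X) M†` for every `E ∈ S`. -/
def Maskable {m n : Type*} [Fintype m] [DecidableEq m] [Fintype n] [DecidableEq n]
    (S : Set (QChannel m n)) : Prop :=
  ∃ (a b : ℕ) (M : Matrix (Fin a × Fin b) n ℂ), Mᴴ * M = 1 ∧
    ∃ (α : QChannel m (Fin a)) (β : QChannel m (Fin b)), ∀ E ∈ S, ∀ X : Matrix m m ℂ,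
      α.apply X = traceB (M * E.apply X * Mᴴ) ∧ β.apply X = traceA (M * E.apply X * Mᴴ)

/-- The operator `|ψ⟩⟨ψ|`. -/
def ketbra {n : Type*} (ψ : EuclideanSpace ℂ n) : Matrix n n ℂ :=
  Matrix.vecMulVec ψ.ofLp (star ψ.ofLp)

end

/-! ### Rank-one projections and Hermitian operators on `ℂ²`. -/

namespace Matrix

/-! The operators `Y` for which both marginals of `M Y M†` vanish form a `†`-closed space of
traceless matrices, and masking `id` together with `E` puts every `E X - X` in it. By
`exists_traceless_not_masked` this space is not all traceless matrices, so a non-scalar Hermitian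
`K` is orthogonal to it. With `P` the projection onto an eigenvector of `K`, `Tr(P Y)` is a
combination of `Tr Y` and `Tr(K Y)`, hence zero on the space. So `E` preserves the expectation of
`P`, and positivity then makes it fix `P` and `1 - P`.

Conversely, a unital `E` fixing `P` preserves the expectations of `P` and `1 - P`. Copying that
basis, `|v k⟩ ↦ |k⟩|k⟩`, leaves each side with only those expectations, which are the same for all
channels. -/

/-- For a unit vector `v` of `ℂ²`, the unit vector orthogonal to `v`. -/
def perp (v : Fin 2 → ℂ) : Fin 2 → ℂ := ![-star (v 1), star (v 0)]

theorem vecMulVec_perp {v : Fin 2 → ℂ} (hv : star v ⬝ᵥ v = 1) :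
    vecMulVec (perp v) (star (perp v)) = 1 - vecMulVec v (star v) := by
  simp only [dotProduct, Fin.sum_univ_two, Pi.star_apply] at hv
  ext i j
  fin_cases i <;> fin_cases j <;>
    simp [perp, vecMulVec_apply] at hv ⊢ <;> first | ring1 | linear_combination hv

theorem perp_unit {v : Fin 2 → ℂ} (hv : star v ⬝ᵥ v = 1) : star (perp v) ⬝ᵥ perp v = 1 := by
  simp only [dotProduct, Fin.sum_univ_two, Pi.star_apply] at hv
  simp [perp, dotProduct, Fin.sum_univ_two] at hv ⊢
  linear_combination hv

theorem trace_vecMulVec_star_mul {n : Type*} [Fintype n] (v : n → ℂ) (Y : Matrix n n ℂ) :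
    (vecMulVec v (star v) * Y).trace = star v ⬝ᵥ Y *ᵥ v := by
  rw [vecMulVec_mul, trace_vecMulVec, dotProduct_comm, dotProduct_mulVec]

theorem trace_vecMulVec_star_self {n : Type*} [Fintype n] {v : n → ℂ} (hv : star v ⬝ᵥ v = 1) :
    (vecMulVec v (star v)).trace = 1 := by
  rw [trace_vecMulVec, dotProduct_comm, hv]

/-- A Hermitian operator on `ℂ²` that kills the unit vector `v` is a multiple of the projection
onto the orthogonal complement of `v`. -/
theorem IsHermitian.eq_smul_of_mulVec_eq_zero {R : Matrix (Fin 2) (Fin 2) ℂ} (hR : R.IsHermitian)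
    {v : Fin 2 → ℂ} (hv : star v ⬝ᵥ v = 1) (h : R *ᵥ v = 0) :
    R = R.trace • (1 - vecMulVec v (star v)) := by
  have h1 : R * vecMulVec v (star v) = 0 := by rw [mul_vecMulVec, h, zero_vecMulVec]
  have h2 : vecMulVec v (star v) * R = 0 := by
    rw [vecMulVec_mul, ← hR.eq, ← star_mulVec, h, star_zero, vecMulVec_zero]
  have h3 : R = vecMulVec (perp v) (star (perp v)) * R * vecMulVec (perp v) (star (perp v)) := by
    rw [vecMulVec_perp hv]
    simp [sub_mul, mul_sub, h1, h2]
  have h4 : R = (star (perp v) ⬝ᵥ R *ᵥ perp v) • vecMulVec (perp v) (star (perp v)) := by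
    conv_lhs => rw [h3]
    rw [Matrix.mul_assoc, mul_vecMulVec, vecMulVec_mul_vecMulVec, vecMulVec_smul]
  have h5 : R.trace = star (perp v) ⬝ᵥ R *ᵥ perp v := by
    conv_lhs => rw [h4]
    rw [trace_smul, trace_vecMulVec_star_self (perp_unit hv), smul_eq_mul, mul_one]
  rw [h5, ← vecMulVec_perp hv]
  exact h4

/-- Zero expectation of a positive operator at `v` forces `R v = 0`. -/
theorem PosSemidef.eq_smul_of_trace_eq_zero {R : Matrix (Fin 2) (Fin 2) ℂ} (hR : R.PosSemidef)
    {v : Fin 2 → ℂ} (hv : star v ⬝ᵥ v = 1) (h : (vecMulVec v (star v) * R).trace = 0) :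
    R = R.trace • (1 - vecMulVec v (star v)) := by
  rw [trace_vecMulVec_star_mul] at h
  exact hR.1.eq_smul_of_mulVec_eq_zero hv ((hR.dotProduct_mulVec_zero_iff v).1 h)

/-- A Hermitian `2 × 2` matrix that is not scalar has an eigenvector `v` such that every traceless
matrix orthogonal to it has vanishing expectation at `v`. -/
theorem IsHermitian.exists_unit_of_not_scalar {K : Matrix (Fin 2) (Fin 2) ℂ} (hK : K.IsHermitian)
    (hs : ∀ c : ℂ, K ≠ c • 1) :
    ∃ v : Fin 2 → ℂ, star v ⬝ᵥ v = 1 ∧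
      ∀ Y : Matrix (Fin 2) (Fin 2) ℂ, Y.trace = 0 → (K * Y).trace = 0 →
        (vecMulVec v (star v) * Y).trace = 0 := by
  set v : Fin 2 → ℂ := (hK.eigenvectorBasis 0).ofLp with hvdef
  set μ : ℂ := (hK.eigenvalues 0 : ℂ) with hμ
  have hv : star v ⬝ᵥ v = 1 := by
    have := hK.eigenvectorBasis.orthonormal.1 0
    have h2 := inner_self_eq_norm_sq_to_K (𝕜 := ℂ) (hK.eigenvectorBasis 0)
    rw [this, EuclideanSpace.inner_eq_star_dotProduct, dotProduct_comm] at h2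
    simpa using h2
  have hR : (K - μ • 1).IsHermitian := by
    refine hK.sub ?_
    rw [IsHermitian, conjTranspose_smul, conjTranspose_one, hμ]
    simp
  have hRv : (K - μ • 1) *ᵥ v = 0 := by
    have := hK.mulVec_eigenvectorBasis 0
    rw [sub_mulVec, smul_mulVec, one_mulVec, hvdef, this, hμ]
    ext i
    simp
  refine ⟨v, hv, fun Y hY hKY => ?_⟩
  have hA := hR.eq_smul_of_mulVec_eq_zero hv hRv
  -- Otherwise `K` is scalar; so `1 - P` is a nonzero multiple of `K - μ`.
  have ht : (K - μ • 1).trace ≠ 0 := by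
    intro h0
    rw [h0, zero_smul, sub_eq_zero] at hA
    exact hs μ hA
  have h1 : ((K - μ • 1) * Y).trace = 0 := by
    simp [sub_mul, hY, hKY]
  rw [hA, smul_mul, trace_smul, smul_eq_mul] at h1
  have h2 := (mul_eq_zero.1 h1).resolve_left ht
  rwa [sub_mul, one_mul, trace_sub, hY, zero_sub, neg_eq_zero] at h2

end Matrix

open Matrix

/-! ### Operators hidden from both subsystems. -/

theorem trace_traceB {a b : Type*} [Fintype a] [Fintype b] (X : Matrix (a × b) (a × b) ℂ) :
    (traceB X).trace = X.trace := by
  simp [traceB, Matrix.trace, Fintype.sum_prod_type]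

theorem traceB_conjTranspose {a b : Type*} [Fintype b] (X : Matrix (a × b) (a × b) ℂ) :
    traceB Xᴴ = (traceB X)ᴴ := by
  ext i j
  simp [traceB]

theorem traceA_conjTranspose {a b : Type*} [Fintype a] (X : Matrix (a × b) (a × b) ℂ) :
    traceA Xᴴ = (traceA X)ᴴ := by
  ext i j
  simp [traceA]

theorem traceB_sub {a b : Type*} [Fintype b] (X Y : Matrix (a × b) (a × b) ℂ) :
    traceB (X - Y) = traceB X - traceB Y := by
  ext i j
  simp [traceB]

theorem traceA_sub {a b : Type*} [Fintype a] (X Y : Matrix (a × b) (a × b) ℂ) :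
    traceA (X - Y) = traceA X - traceA Y := by
  ext i j
  simp [traceA]

theorem trace_isometry_conj {m n : Type*} [Fintype m] [Fintype n] [DecidableEq n]
    {M : Matrix m n ℂ} (hM : Mᴴ * M = 1) (Y : Matrix n n ℂ) : (M * Y * Mᴴ).trace = Y.trace := by
  rw [trace_mul_comm, ← Matrix.mul_assoc, hM, one_mul]

/-- Every linear functional on matrices is `Y ↦ Tr(K Y)`. -/
theorem exists_trace_mul_eq {n : Type*} [Fintype n] [DecidableEq n] (f : Matrix n n ℂ →ₗ[ℂ] ℂ) :
    ∃ K : Matrix n n ℂ, ∀ Y, (K * Y).trace = f Y := by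
  refine ⟨Matrix.of fun i j => f (single j i 1), fun Y => ?_⟩
  conv_rhs => rw [matrix_eq_sum_single Y]
  simp only [Matrix.trace, diag_apply, Matrix.mul_apply, of_apply, map_sum]
  rw [Finset.sum_comm]
  refine Finset.sum_congr rfl fun i _ => Finset.sum_congr rfl fun j _ => ?_
  have : single i j (Y i j) = Y i j • single i j (1 : ℂ) := by simp
  rw [this, map_smul, smul_eq_mul, mul_comm]

/-- No isometry hides all traceless operators of a qubit from both subsystems. -/
theorem exists_traceless_not_masked {a b : Type*} [Fintype a] [Fintype b]
    {M : Matrix (a × b) (Fin 2) ℂ} (hM : Mᴴ * M = 1) :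
    ¬ ∀ Y : Matrix (Fin 2) (Fin 2) ℂ, Y.trace = 0 →
      traceB (M * Y * Mᴴ) = 0 ∧ traceA (M * Y * Mᴴ) = 0 := by
  intro h
  let N : Fin 2 → Matrix a b ℂ := fun k => Matrix.of fun i j => M (i, j) k
  have h1 : N 0 * (N 0)ᴴ = N 1 * (N 1)ᴴ := by
    have := (h !![1, 0; 0, -1] (by simp [trace_fin_two])).1
    ext i i'
    have h2 := congrFun (congrFun this i) i'
    simp [traceB, Matrix.mul_apply, Fin.sum_univ_two, Finset.sum_add_distrib] at h2
    simp [N, Matrix.mul_apply]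
    linear_combination h2
  have h2 : (N 0)ᴴ * N 1 = 0 := by
    have := (h !![0, 0; 1, 0] (by simp [trace_fin_two])).2
    ext j j'
    have h2 := congrFun (congrFun this j') j
    simp [traceA, Matrix.mul_apply, Fin.sum_univ_two] at h2
    simp [N, Matrix.mul_apply]
    simpa [mul_comm] using h2
  -- The square of `N₀N₀†` is `N₀N₀†N₁N₁† = 0`, so the unit column `N₀` of `M` would vanish.
  have h3 : (N 0 * (N 0)ᴴ) * (N 0 * (N 0)ᴴ)ᴴ = 0 := by
    rw [conjTranspose_mul, conjTranspose_conjTranspose]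
    conv_lhs => rw [h1, ← h1]
    conv_lhs => enter [2]; rw [h1]
    rw [Matrix.mul_assoc, ← Matrix.mul_assoc _ (N 1), h2]
    simp
  have h4 : N 0 = 0 := self_mul_conjTranspose_eq_zero.1 (self_mul_conjTranspose_eq_zero.1 h3)
  have h5 := congrFun (congrFun hM 0) 0
  rw [Matrix.mul_apply] at h5
  have h6 : ∀ p, M p 0 = 0 := fun p => congrFun (congrFun h4 p.1) p.2
  simp [h6] at h5

/-- For every isometry from a qubit into a bipartite system, there is a unit vector whose
expectation vanishes on all traceless operators hidden from both subsystems. -/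
theorem exists_unit_expectation_eq_zero {a b : Type*} [Fintype a] [Fintype b]
    {M : Matrix (a × b) (Fin 2) ℂ} (hM : Mᴴ * M = 1) :
    ∃ v : Fin 2 → ℂ, star v ⬝ᵥ v = 1 ∧ ∀ Y : Matrix (Fin 2) (Fin 2) ℂ,
      traceB (M * Y * Mᴴ) = 0 → traceA (M * Y * Mᴴ) = 0 →
        (vecMulVec v (star v) * Y).trace = 0 := by
  classical
  let V : Matrix (Fin 2) (Fin 2) ℂ → Prop := fun Y =>
    traceB (M * Y * Mᴴ) = 0 ∧ traceA (M * Y * Mᴴ) = 0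
  have hVstar : ∀ Y, V Y → V Yᴴ := by
    intro Y hY
    have : M * Yᴴ * Mᴴ = (M * Y * Mᴴ)ᴴ := by
      simp [conjTranspose_mul, Matrix.mul_assoc]
    refine ⟨?_, ?_⟩
    · rw [this, traceB_conjTranspose, hY.1, conjTranspose_zero]
    · rw [this, traceA_conjTranspose, hY.2, conjTranspose_zero]
  have hVtr : ∀ Y, V Y → Y.trace = 0 := by
    intro Y hY
    rw [← trace_isometry_conj hM, ← trace_traceB, hY.1, trace_zero]
  by_cases hex : ∃ K : Matrix (Fin 2) (Fin 2) ℂ, K.IsHermitian ∧ (∀ c : ℂ, K ≠ c • 1) ∧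
      ∀ Y, V Y → (K * Y).trace = 0
  · obtain ⟨K, hK, hs, hKV⟩ := hex
    obtain ⟨v, hv, h⟩ := hK.exists_unit_of_not_scalar hs
    exact ⟨v, hv, fun Y hB hA => h Y (hVtr Y ⟨hB, hA⟩) (hKV Y ⟨hB, hA⟩)⟩
  · exfalso
    push Not at hex
    have hstar : ∀ K : Matrix (Fin 2) (Fin 2) ℂ, (∀ Y, V Y → (K * Y).trace = 0) →
        ∀ Y, V Y → (Kᴴ * Y).trace = 0 := by
      intro K hK Y hY
      have := hK _ (hVstar Y hY)
      rw [← conjTranspose_conjTranspose Y, ← conjTranspose_mul, trace_conjTranspose,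
        trace_mul_comm, this, star_zero]
    have hherm : ∀ K : Matrix (Fin 2) (Fin 2) ℂ, K.IsHermitian →
        (∀ Y, V Y → (K * Y).trace = 0) → ∃ c : ℂ, K = c • 1 := by
      intro K hK h
      by_contra! hc
      obtain ⟨Y, hY, hne⟩ := hex K hK hc
      exact hne (h Y hY)
    -- Splitting `K` into Hermitian parts shows that every functional killing the hidden operators
    -- is a multiple of the trace. Each entry of a marginal is such a functional, so all traceless
    -- operators would be hidden.
    have hall : ∀ K : Matrix (Fin 2) (Fin 2) ℂ,
        (∀ Y, V Y → (K * Y).trace = 0) → ∃ c : ℂ, K = c • 1 := by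
      intro K hK
      obtain ⟨c, hc⟩ := hherm (K + Kᴴ) (isHermitian_add_transpose_self K) (by
        intro Y hY
        rw [add_mul, trace_add, hK Y hY, hstar K hK Y hY, add_zero])
      obtain ⟨d, hd⟩ := hherm (Complex.I • (K - Kᴴ)) (by
        rw [IsHermitian, conjTranspose_smul, conjTranspose_sub, conjTranspose_conjTranspose]
        ext i j
        simp
        ring) (by
        intro Y hY
        rw [smul_mul, trace_smul, sub_mul, trace_sub, hK Y hY, hstar K hK Y hY]
        simp)
      refine ⟨(1 / 2) * (c - Complex.I * d), ?_⟩
      rw [mul_smul, sub_smul, mul_smul, ← hc, ← hd, smul_smul, Complex.I_mul_I]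
      ext i j
      simp
      ring
    refine exists_traceless_not_masked hM fun Y hY => ⟨?_, ?_⟩
    · ext i i'
      let f : Matrix (Fin 2) (Fin 2) ℂ →ₗ[ℂ] ℂ :=
        { toFun := fun Y => traceB (M * Y * Mᴴ) i i'
          map_add' := by
            intro Y Z
            simp [traceB, Matrix.mul_add, Matrix.add_mul, Finset.sum_add_distrib]
          map_smul' := by
            intro c Y
            simp [traceB, Finset.mul_sum] }
      obtain ⟨K, hK⟩ := exists_trace_mul_eq f
      obtain ⟨c, rfl⟩ := hall K fun Y hY => by
        rw [hK]
        exact congrFun (congrFun hY.1 i) i'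
      change f Y = 0
      rw [← hK, smul_mul, one_mul, trace_smul, hY, smul_zero]
    · ext i i'
      let f : Matrix (Fin 2) (Fin 2) ℂ →ₗ[ℂ] ℂ :=
        { toFun := fun Y => traceA (M * Y * Mᴴ) i i'
          map_add' := by
            intro Y Z
            simp [traceA, Matrix.mul_add, Matrix.add_mul, Finset.sum_add_distrib]
          map_smul' := by
            intro c Y
            simp [traceA, Finset.mul_sum] }
      obtain ⟨K, hK⟩ := exists_trace_mul_eq f
      obtain ⟨c, rfl⟩ := hall K fun Y hY => by
        rw [hK]
        exact congrFun (congrFun hY.2 i) i'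
      change f Y = 0
      rw [← hK, smul_mul, one_mul, trace_smul, hY, smul_zero]

/-! ### Channels fixing a pure state. -/

namespace QChannel

variable {m n : Type*} [Fintype m] [DecidableEq m] [Fintype n] [DecidableEq n]

theorem apply_posSemidef (E : QChannel m n) {X : Matrix m m ℂ} (hX : X.PosSemidef) :
    (E.apply X).PosSemidef := by
  rw [← Matrix.nonneg_iff_posSemidef] at hX ⊢
  exact map_nonneg E.toCompletelyPositiveMap hX

theorem apply_conjTranspose (E : QChannel m n) (X : Matrix m m ℂ) :
    E.apply Xᴴ = (E.apply X)ᴴ :=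
  map_star E.toCompletelyPositiveMap X

theorem trace_apply (E : QChannel m n) (X : Matrix m m ℂ) : (E.apply X).trace = X.trace :=
  E.trace_preserving X

theorem apply_add (E : QChannel m n) (X Y : Matrix m m ℂ) :
    E.apply (X + Y) = E.apply X + E.apply Y := map_add E.toCompletelyPositiveMap X Y

theorem apply_sub (E : QChannel m n) (X Y : Matrix m m ℂ) :
    E.apply (X - Y) = E.apply X - E.apply Y := map_sub E.toCompletelyPositiveMap X Y

theorem apply_smul (E : QChannel m n) (c : ℂ) (X : Matrix m m ℂ) :
    E.apply (c • X) = c • E.apply X := map_smul E.toCompletelyPositiveMap c X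

@[simp] theorem ident_apply (X : Matrix m m ℂ) : (ident m).apply X = X := rfl

/-- The channel with the Kraus operators `K j`. -/
def ofKraus {ι : Type*} [Fintype ι] (K : ι → Matrix n n ℂ) (hK : ∑ j, (K j)ᴴ * K j = 1) :
    QChannel n n where
  toFun X := ∑ j, K j * X * (K j)ᴴ
  map_add' X Y := by simp [Matrix.mul_add, Matrix.add_mul, Finset.sum_add_distrib]
  map_smul' c X := by simp [Finset.smul_sum]
  map_cstarMatrix_nonneg' k N hN := by
    -- Conjugation by a block-diagonal matrix applies one Kraus term to every block.
    let D : ι → CStarMatrix (Fin k) (Fin k) (Matrix n n ℂ) := fun j =>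
      CStarMatrix.ofMatrix (Matrix.diagonal fun _ => (K j)ᴴ)
    have h0 : 0 ≤ ∑ j, star (D j) * N * D j :=
      Finset.sum_nonneg fun j _ => star_left_conjugate_nonneg hN (D j)
    have h1 (j : ι) (p q : Fin k) : (star (D j) * N * D j) p q = K j * N p q * (K j)ᴴ := by
      simp [D, CStarMatrix.mul_apply, CStarMatrix.star_apply, diagonal_apply, star_eq_conjTranspose,
        apply_ite]
    refine h0.trans_eq (CStarMatrix.ext fun p q => ?_)
    change (∑ j, star (D j) * N * D j) p q = ∑ j, K j * N p q * (K j)ᴴ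
    simp_rw [← h1]
    exact map_sum (Matrix.entryAddMonoidHom (Matrix n n ℂ) p q) _ _
  trace_preserving X := by
    simp_rw [trace_sum, trace_mul_comm _ (K _)ᴴ, ← Matrix.mul_assoc]
    rw [← trace_sum, ← Finset.sum_mul, hK, one_mul]

/-- A qubit channel that fixes, in expectation, a pure state is unital and fixes that state. -/
theorem unital_and_fixed {E : QChannel (Fin 2) (Fin 2)} {v : Fin 2 → ℂ} (hv : star v ⬝ᵥ v = 1)
    (h : ∀ X, (vecMulVec v (star v) * (E.apply X - X)).trace = 0) :
    E.IsUnital ∧ E.apply (vecMulVec v (star v)) = vecMulVec v (star v) := by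
  set P := vecMulVec v (star v) with hP
  have hPP : P * P = P := by rw [hP, vecMulVec_mul_vecMulVec, hv, one_smul]
  have hPt : P.trace = 1 := trace_vecMulVec_star_self hv
  have hQ := vecMulVec_perp hv
  have h1t : (1 : Matrix (Fin 2) (Fin 2) ℂ).trace = 2 := by simp
  have hQpos : (1 - P).PosSemidef := by
    rw [← hQ]
    exact posSemidef_vecMulVec_self_star _
  have hEQ : E.apply (1 - P) = 1 - P := by
    have := (E.apply_posSemidef hQpos).eq_smul_of_trace_eq_zero hv (by
      have := h (1 - P)
      rw [mul_sub, trace_sub, sub_eq_zero] at this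
      rw [this]
      simp [mul_sub, hPP])
    rw [this, trace_apply, trace_sub, hPt, h1t]
    norm_num [hP]
  have hEP : E.apply P = P := by
    have := (E.apply_posSemidef (posSemidef_vecMulVec_self_star v)).eq_smul_of_trace_eq_zero
      (perp_unit hv) (by
      have := h P
      rw [mul_sub, trace_sub, sub_eq_zero] at this
      rw [hQ, ← hP, sub_mul, trace_sub, this, one_mul, trace_apply, hPP, sub_self])
    rw [← hP, trace_apply, hPt, hQ, one_smul, ← hP, sub_sub_cancel] at this
    exact this
  refine ⟨?_, hEP⟩
  have := E.apply_add (1 - P) P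
  rw [hEQ, hEP, sub_add_cancel] at this
  exact this

/-- A unital qubit channel that fixes a pure state preserves its expectation. -/
theorem trace_mul_apply_of_fixed {E : QChannel (Fin 2) (Fin 2)} (hE : E.IsUnital)
    {v : Fin 2 → ℂ} (hv : star v ⬝ᵥ v = 1)
    (h : E.apply (vecMulVec v (star v)) = vecMulVec v (star v)) (X : Matrix (Fin 2) (Fin 2) ℂ) :
    (vecMulVec v (star v) * E.apply X).trace = (vecMulVec v (star v) * X).trace := by
  set P := vecMulVec v (star v) with hP
  have hPP : P * P = P := by rw [hP, vecMulVec_mul_vecMulVec, hv, one_smul]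
  have hPt : P.trace = 1 := trace_vecMulVec_star_self hv
  have hPpos : P.PosSemidef := posSemidef_vecMulVec_self_star v
  have hQ := vecMulVec_perp hv
  -- `G` is the adjoint of `E` applied to `P`: it is positive, has trace one by unitality and is
  -- orthogonal to `1 - P`, so `G = P`.
  obtain ⟨G, hG⟩ := exists_trace_mul_eq
    ({ toFun := fun X => (P * E.apply X).trace
       map_add' := fun X Y => by rw [apply_add, mul_add, trace_add]
       map_smul' := fun c X => by rw [apply_smul, mul_smul_comm, trace_smul]; rfl } :
      Matrix (Fin 2) (Fin 2) ℂ →ₗ[ℂ] ℂ)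
  simp only [LinearMap.coe_mk, AddHom.coe_mk] at hG
  have hGH : G.IsHermitian := by
    refine ext_iff_trace_mul_right.2 fun Y => ?_
    rw [← conjTranspose_conjTranspose Y, ← conjTranspose_mul, trace_conjTranspose, trace_mul_comm,
      hG, hG, apply_conjTranspose, ← trace_conjTranspose, conjTranspose_mul, hPpos.1.eq,
      trace_mul_comm, conjTranspose_conjTranspose, conjTranspose_conjTranspose]
  have hGpos : G.PosSemidef := by
    refine .of_dotProduct_mulVec_nonneg hGH fun x => ?_
    rw [← trace_vecMulVec_star_mul, trace_mul_comm, hG, hP, trace_vecMulVec_star_mul]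
    exact (E.apply_posSemidef (posSemidef_vecMulVec_self_star x)).dotProduct_mulVec_nonneg v
  have hEQ : E.apply (1 - P) = 1 - P := by rw [apply_sub, h, hE]
  have hGP := hGpos.eq_smul_of_trace_eq_zero (perp_unit hv) (by
    rw [hQ, trace_mul_comm, ← hP, hG, hEQ, mul_sub, hPP]
    simp)
  have hGt : G.trace = 1 := by
    have := hG 1
    rwa [hE, mul_one, mul_one, hPt] at this
  rw [hGt, hQ, one_smul, ← hP, sub_sub_cancel] at hGP
  rw [← hG, hGP]

end QChannel

/-! ### Masking by copying a basis. -/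

/-- The isometry `|v k⟩ ↦ |k⟩ ⊗ |k⟩` copying the vectors of an orthonormal basis `v`. -/
def copyIsometry {n : Type*} [DecidableEq n] (v : n → n → ℂ) : Matrix (n × n) n ℂ :=
  Matrix.of fun p q => if p.1 = p.2 then star (v p.1 q) else 0

section copyIsometry

variable {n : Type*} [Fintype n] [DecidableEq n] {v : n → n → ℂ}

theorem copyIsometry_isometry (hv : ∑ k, vecMulVec (v k) (star (v k)) = 1) :
    (copyIsometry v)ᴴ * copyIsometry v = 1 := by
  rw [← hv]
  ext q q'
  simp [copyIsometry, Matrix.mul_apply, Fintype.sum_prod_type, Matrix.sum_apply, vecMulVec_apply]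

theorem copyIsometry_conj_apply (Y : Matrix n n ℂ) (p p' : n × n) :
    (copyIsometry v * Y * (copyIsometry v)ᴴ) p p' =
      if p.1 = p.2 ∧ p'.1 = p'.2 then star (v p.1) ⬝ᵥ Y *ᵥ v p'.1 else 0 := by
  rw [dotProduct_mulVec]
  by_cases h : p.1 = p.2 <;> by_cases h' : p'.1 = p'.2 <;>
    simp [copyIsometry, Matrix.mul_apply, dotProduct, vecMul, h, h']

/-- The traced-out copy records the basis index, so all coherences vanish. -/
theorem traceB_copyIsometry (Y : Matrix n n ℂ) :
    traceB (copyIsometry v * Y * (copyIsometry v)ᴴ) =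
      diagonal fun k => star (v k) ⬝ᵥ Y *ᵥ v k := by
  ext i i'
  simp only [traceB, of_apply, copyIsometry_conj_apply, diagonal_apply]
  by_cases h : i = i'
  · subst h
    simp
  · rw [if_neg h]
    exact Finset.sum_eq_zero fun j _ => if_neg fun hj => h (hj.1.trans hj.2.symm)

theorem traceA_copyIsometry (Y : Matrix n n ℂ) :
    traceA (copyIsometry v * Y * (copyIsometry v)ᴴ) =
      diagonal fun k => star (v k) ⬝ᵥ Y *ᵥ v k := by
  ext j j'
  simp only [traceA, of_apply, copyIsometry_conj_apply, diagonal_apply]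
  by_cases h : j = j'
  · subst h
    simp
  · rw [if_neg h]
    exact Finset.sum_eq_zero fun i _ => if_neg fun hi => h (hi.1.symm.trans hi.2)

/-- The measurement in the orthonormal basis `v`. -/
def QChannel.measure (v : n → n → ℂ) (hv : ∑ k, vecMulVec (v k) (star (v k)) = 1) :
    QChannel n n :=
  QChannel.ofKraus (fun k => vecMulVec (Pi.single k 1) (star (v k))) (by
    rw [← hv]
    refine Finset.sum_congr rfl fun k _ => ?_
    rw [conjTranspose_vecMulVec, star_star, vecMulVec_mul_vecMulVec]
    simp)

theorem QChannel.measure_apply (hv : ∑ k, vecMulVec (v k) (star (v k)) = 1) (X : Matrix n n ℂ) :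
    (QChannel.measure v hv).apply X = diagonal fun k => star (v k) ⬝ᵥ X *ᵥ v k := by
  have h (k : n) : vecMulVec (Pi.single k 1) (star (v k)) * X *
      (vecMulVec (Pi.single k 1) (star (v k)))ᴴ = single k k (star (v k) ⬝ᵥ X *ᵥ v k) := by
    rw [conjTranspose_vecMulVec, star_star, vecMulVec_mul, vecMulVec_mul_vecMulVec,
      ← dotProduct_mulVec]
    ext i j
    by_cases hi : k = i <;> by_cases hj : k = j <;>
      simp [vecMulVec_apply, single_apply, Pi.single_apply, hi, hj, eq_comm]
  change ∑ k, vecMulVec (Pi.single k 1) (star (v k)) * X *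
    (vecMulVec (Pi.single k 1) (star (v k)))ᴴ = _
  simp_rw [h]
  ext i j
  by_cases hij : i = j
  · subst hij
    simp [Matrix.sum_apply, single_apply]
  · rw [Matrix.sum_apply, diagonal_apply_ne _ hij]
    exact Finset.sum_eq_zero fun k _ =>
      single_apply_of_ne _ _ _ _ _ fun hk => hij (hk.1.symm.trans hk.2)

end copyIsometry

/-- A set of channels all of which have the same outcome distribution, input by input, for the
measurement in some orthonormal basis is maskable. -/
theorem maskable_of_expectation_eq {d : ℕ} {S : Set (QChannel (Fin d) (Fin d))}
    (v : Fin d → Fin d → ℂ) (hv : ∑ k, vecMulVec (v k) (star (v k)) = 1)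
    (h : ∀ E ∈ S, ∀ X k, star (v k) ⬝ᵥ E.apply X *ᵥ v k = star (v k) ⬝ᵥ X *ᵥ v k) :
    Maskable S := by
  refine ⟨d, d, copyIsometry v, copyIsometry_isometry hv, QChannel.measure v hv,
    QChannel.measure v hv, fun E hE X => ?_⟩
  rw [QChannel.measure_apply, traceB_copyIsometry, traceA_copyIsometry]
  simp_rw [h E hE X]
  exact ⟨trivial, trivial⟩

theorem EuclideanSpace.norm_eq_one_iff_dotProduct {n : Type*} [Fintype n]
    (ψ : EuclideanSpace ℂ n) : ‖ψ‖ = 1 ↔ star ψ.ofLp ⬝ᵥ ψ.ofLp = 1 := by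
  have h := inner_self_eq_norm_sq_to_K (𝕜 := ℂ) ψ
  rw [EuclideanSpace.inner_eq_star_dotProduct, dotProduct_comm] at h
  rw [h]
  constructor
  · intro h1
    simp [h1]
  · intro h1
    have h2 : ((‖ψ‖ ^ 2 : ℝ) : ℂ) = (1 : ℝ) := by simpa using h1
    exact (pow_eq_one_iff_of_nonneg (norm_nonneg ψ) two_ne_zero).1 (Complex.ofReal_injective h2)

theorem mainTheorem4 {ι : Type*} (E : ι → QChannel (Fin 2) (Fin 2)) :
    Maskable (insert (QChannel.ident (Fin 2)) (Set.range E)) ↔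
      (∀ i, (E i).IsUnital) ∧
        ∃ ψ : EuclideanSpace ℂ (Fin 2), ‖ψ‖ = 1 ∧ ∀ i, (E i).apply (ketbra ψ) = ketbra ψ := by
  constructor
  · rintro ⟨a, b, M, hM, α, β, h⟩
    obtain ⟨v, hv, hV⟩ := exists_unit_expectation_eq_zero hM
    have key (i : ι) := QChannel.unital_and_fixed (E := E i) hv fun X => by
      have h0 := h _ (Set.mem_insert _ _) X
      have h1 := h _ (Set.mem_insert_of_mem _ (Set.mem_range_self i)) X
      rw [QChannel.ident_apply] at h0
      refine hV _ ?_ ?_ <;> rw [Matrix.mul_sub, Matrix.sub_mul]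
      · rw [traceB_sub, ← h0.1, ← h1.1, sub_self]
      · rw [traceA_sub, ← h0.2, ← h1.2, sub_self]
    exact ⟨fun i => (key i).1, WithLp.toLp 2 v,
      (EuclideanSpace.norm_eq_one_iff_dotProduct _).2 hv, fun i => (key i).2⟩
  · rintro ⟨hE, ψ, hψ, hfix⟩
    have hv := (EuclideanSpace.norm_eq_one_iff_dotProduct ψ).1 hψ
    refine maskable_of_expectation_eq ![ψ.ofLp, perp ψ.ofLp] ?_ ?_
    · rw [Fin.sum_univ_two]
      simp [vecMulVec_perp hv]
    · rintro _ (rfl | ⟨i, rfl⟩) X k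
      · rfl
      · have h := QChannel.trace_mul_apply_of_fixed (hE i) hv (hfix i) X
        rw [← trace_vecMulVec_star_mul, ← trace_vecMulVec_star_mul]
        fin_cases k
        · exact h
        -- The second projection is `1 - P`, handled by trace preservation.
        · simp [vecMulVec_perp hv, sub_mul, h, QChannel.trace_apply]
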